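/- Let $K$ be a field and let $n\ge 3$. Let $S_n$ be the monoid with generators $a_1,\dots,a_n$ and relations $a_1a_2\cdots a_n=a_{\sigma(1)}a_{\sigma(2)}\cdots a_{\sigma(n)}$ for all $\sigma$ in the cyclic subgroup of $\operatorname{Sym}_n$ generated by the cycle $(1,2,\dots,n)$, and let $K[S_n]$ be its monoid algebra over $K$. Then $K[S_n]$ is right primitive (that is, it has a faithful simple right module) if and only if $K$ is countable (finite fields included). Likewise, $K[S_n]$ is left primitive (that is, it has a faithful simple left module) if and only if $K$ is countable. -/

import Mathlib

universe u

/-- A ring `R` is left primitive if it has a faithful simple left module. (Every simple left module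
is a quotient of `R` by a left ideal, so modules in the universe of `R` suffice.) -/
def IsLeftPrimitive (R : Type u) [Ring R] : Prop :=
  ∃ (M : Type u) (_ : AddCommGroup M) (_ : Module R M), IsSimpleModule R M ∧ FaithfulSMul R M

/-- A ring `R` is right primitive if it has a faithful simple right module; right `R`-modules are
modules over the opposite ring. -/
def IsRightPrimitive (R : Type u) [Ring R] : Prop :=
  ∃ (M : Type u) (_ : AddCommGroup M) (_ : Module Rᵐᵒᵖ M),
    IsSimpleModule Rᵐᵒᵖ M ∧ FaithfulSMul Rᵐᵒᵖ M

/-- The word `a_{σ(1)} a_{σ(2)} ⋯ a_{σ(n)}` in the free monoid on `a_1, …, a_n`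
(the generators are indexed by `Fin n`). -/
def permWord (n : ℕ) (σ : Equiv.Perm (Fin n)) : FreeMonoid (Fin n) :=
  (List.ofFn fun i : Fin n => FreeMonoid.of (σ i)).prod

/-- The relations `a_1 a_2 ⋯ a_n = a_{σ(1)} a_{σ(2)} ⋯ a_{σ(n)}`, for `σ ∈ H`. -/
def permRel (n : ℕ) (H : Set (Equiv.Perm (Fin n))) (u v : FreeMonoid (Fin n)) : Prop :=
  ∃ σ ∈ H, u = permWord n 1 ∧ v = permWord n σ

/-- The monoid `S_n(H)` with generators `a_1, …, a_n` and relations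
`a_1 a_2 ⋯ a_n = a_{σ(1)} a_{σ(2)} ⋯ a_{σ(n)}`, for `σ ∈ H`. -/
abbrev PermMonoid (n : ℕ) (H : Set (Equiv.Perm (Fin n))) : Type :=
  PresentedMonoid (permRel n H)

/-- The monoid `S_n = S_n(H)` for `H` the cyclic group generated by the cycle `(1, 2, …, n)`. -/
abbrev CyclicMonoid (n : ℕ) : Type :=
  PermMonoid n (Subgroup.zpowers (finRotate n) : Set (Equiv.Perm (Fin n)))

/-! The word `z = a_1 ⋯ a_n` is central, and every element is uniquely `z ^ k * w` with `w` a normal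
word: deleting full cycles is a confluent reduction, proved by letting the monoid act on normal
words (`foldr_push_run`).

Primitive implies countable: `z` is central and transcendental, so on a faithful simple module every
nonzero polynomial in `z` acts bijectively, by Schur's lemma. For `m ≠ 0`, the solutions of `(z - k)
w_k = m`, `k ∈ K`, are linearly independent, as partial fractions are. The module is a quotient of
an algebra of countable dimension, so `K` is countable.

Countable implies primitive: number the nonzero elements `r` by `φ` and let `g` be the sum of the
generators. The left ideal generated by all `g * r * g * marker (φ r) - 1` is proper
(`span_ne_top`), and a maximal left ideal above it has a faithful simple quotient. Properness is a
unique product argument (`exists_unique_prod`): `g` supplies every letter, so two top words can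
always be joined without creating a cycle, and the marker reveals which generator of the ideal was
used.

The two sides are exchanged by an anti-automorphism. -/

set_option linter.unusedSectionVars false

/-! ### Normal words and the deletion of full cycles -/

namespace CyclicWord

variable {n : ℕ} [NeZero n]

/-- The word `a, a + 1, …, a + m - 1`. -/
def run (a : Fin n) : ℕ → List (Fin n)
  | 0 => []
  | m + 1 => a :: run (a + 1) m

/-- A word is normal if it has no factor that is a full cycle `a, a + 1, …, a + n - 1`. -/
def Normal (w : List (Fin n)) : Prop :=
  ∀ c, c <:+: w → c.IsChain (fun a b => b = a + 1) → c.length < n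

@[simp] lemma length_run (a : Fin n) (m : ℕ) : (run a m).length = m := by
  induction m generalizing a with
  | zero => rfl
  | succ m ih => simp [run, ih]

lemma run_add (a : Fin n) (p q : ℕ) : run a (p + q) = run a p ++ run (a + p • 1) q := by
  induction p generalizing a with
  | zero => simp [run]
  | succ p ih =>
    rw [Nat.add_right_comm]
    simp only [run, ih, List.cons_append, add_smul, one_smul]
    rw [add_assoc a 1, add_comm 1 (p • (1 : Fin n))]

lemma isChain_run (a : Fin n) (m : ℕ) : (run a m).IsChain (fun a b => b = a + 1) := by
  induction m generalizing a with
  | zero => exact List.isChain_nil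
  | succ m ih =>
    cases m with
    | zero => exact List.isChain_singleton _
    | succ m => exact List.isChain_cons_cons.2 ⟨rfl, ih (a + 1)⟩

lemma eq_run_of_isChain {a : Fin n} {l : List (Fin n)}
    (h : (a :: l).IsChain (fun a b => b = a + 1)) : a :: l = run a (l.length + 1) := by
  induction l generalizing a with
  | nil => rfl
  | cons b l ih =>
    obtain ⟨rfl, h⟩ := List.isChain_cons_cons.1 h
    rw [ih h, length_run]; rfl

lemma card_nsmul_one : n • (1 : Fin n) = 0 := by
  simpa using card_nsmul_eq_zero (G := Fin n) (x := 1)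

lemma run_cycle_succ (a : Fin n) : run a n ++ [a] = a :: run (a + 1) n := by
  have h := run_add a n 1
  rw [card_nsmul_one, add_zero] at h
  exact h.symm

lemma Normal.of_infix {l w : List (Fin n)} (h : Normal w) (hl : l <:+: w) : Normal l :=
  fun c hc => h c (hc.trans hl)

lemma normal_of_length_lt {w : List (Fin n)} (h : w.length < n) : Normal w :=
  fun _ hc _ => hc.length_le.trans_lt h

lemma normal_nil : Normal ([] : List (Fin n)) := normal_of_length_lt (NeZero.pos n)

/-- Normal words can be concatenated if no chain runs across the seam. -/
lemma Normal.append {l r : List (Fin n)} (hl : Normal l) (hr : Normal r)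
    (h : ∀ a ∈ l.getLast?, ∀ b ∈ r.head?, b ≠ a + 1) : Normal (l ++ r) := by
  intro c hc hch
  rcases List.infix_append_iff_ne_nil.1 hc with hc | hc | ⟨c₁, c₂, h₁, h₂, rfl, hs, hp⟩
  · exact hl c hc hch
  · exact hr c hc hch
  · obtain ⟨s, rfl⟩ := hs
    obtain ⟨t, rfl⟩ := hp
    refine absurd ((List.isChain_append.1 hch).2.2 (c₁.getLast h₁) ?_ (c₂.head h₂) ?_)
      (h (c₁.getLast h₁) ?_ (c₂.head h₂) ?_)
    · simp [List.getLast?_eq_some_getLast h₁]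
    · simp [List.head?_eq_some_head h₂]
    · rw [List.getLast?_append_of_ne_nil _ h₁]; simp [List.getLast?_eq_some_getLast h₁]
    · rw [List.head?_append_of_ne_nil _ h₂]; simp [List.head?_eq_some_head h₂]

lemma exists_run_of_not_normal {w : List (Fin n)} (h : ¬ Normal w) :
    ∃ p a q, w = p ++ run a n ++ q := by
  simp only [Normal, not_forall, not_lt] at h
  obtain ⟨c, ⟨p, q, rfl⟩, hch, hn⟩ := h
  cases c with
  | nil => exact absurd hn (by simpa using NeZero.ne n)
  | cons a l =>
    rw [eq_run_of_isChain hch]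
    obtain ⟨k, hk⟩ := Nat.exists_eq_add_of_le hn
    rw [List.length_cons] at hk
    refine ⟨p, a, run (a + n • 1) k ++ q, ?_⟩
    rw [hk, run_add]
    simp

lemma Normal.not_run_prefix {w : List (Fin n)} (h : Normal w) (a : Fin n) : ¬ run a n <+: w :=
  fun hp => absurd (h _ hp.isInfix (isChain_run a n)) (by simp)

lemma exists_run_append (a : Fin n) (w : List (Fin n)) :
    ∃ m w', w = run a m ++ w' ∧ ∀ b ∈ w'.head?, b ≠ a + m • 1 := by
  induction w generalizing a with
  | nil => exact ⟨0, [], rfl, by simp⟩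
  | cons c w ih =>
    by_cases h : c = a
    · obtain ⟨m, w', rfl, hw'⟩ := ih (a + 1)
      refine ⟨m + 1, w', by simp [run, h], ?_⟩
      rwa [add_smul, one_smul, add_comm (m • (1 : Fin n)), ← add_assoc]
    · exact ⟨0, c :: w, rfl, by simpa using h⟩

open Classical in
/-- Left multiplication of a normal word by a letter, with a full cycle deleted if one appears. -/
noncomputable def push (a : Fin n) (w : List (Fin n)) : List (Fin n) :=
  if run a n <+: a :: w then (a :: w).drop n else a :: w

lemma push_run (a : Fin n) (w : List (Fin n)) {l : List (Fin n)} (h : a :: l = run a n ++ w) :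
    push a l = w := by
  rw [push, h, if_pos (List.prefix_append _ _), List.drop_left' (length_run a n)]

lemma push_of_normal {a : Fin n} {w : List (Fin n)} (h : Normal (a :: w)) : push a w = a :: w :=
  if_neg (h.not_run_prefix a)

lemma Normal.push {w : List (Fin n)} (h : Normal w) (a : Fin n) : Normal (push a w) := by
  rw [CyclicWord.push]
  split_ifs with hp
  · rw [List.drop_cons (NeZero.pos n)]
    exact h.of_infix (List.drop_suffix _ _).isInfix
  -- As `w` is normal, a full cycle in `a :: w` can only start at the head, and `hp` excludes that.
  · by_contra hn
    obtain ⟨p, b, q, hw⟩ := exists_run_of_not_normal hn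
    cases p with
    | nil =>
      obtain ⟨k, hk⟩ := Nat.exists_eq_succ_of_ne_zero (NeZero.ne n)
      have hab : a = b := by
        have := congrArg List.head? hw
        rw [show run b n = run b (k + 1) from congrArg _ hk] at this
        simpa [run] using this
      subst hab
      exact hp ⟨q, by simpa using hw.symm⟩
    | cons c p =>
      simp only [List.cons_append, List.cons.injEq] at hw
      exact absurd (h _ ⟨p, q, hw.2.symm⟩ (isChain_run b n)) (by simp)

lemma foldr_push_of_normal {u w : List (Fin n)} (h : Normal (u ++ w)) :
    u.foldr push w = u ++ w := by
  induction u with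
  | nil => rfl
  | cons a u ih =>
    rw [List.foldr_cons, ih (h.of_infix (List.suffix_cons _ _).isInfix)]
    exact push_of_normal h

lemma getLast?_run_succ (a : Fin n) (m : ℕ) : (run a (m + 1)).getLast? = some (a + m • 1) := by
  rw [run_add]; simp [run]

/-- A full cycle acts trivially on normal words. -/
lemma foldr_push_run {w : List (Fin n)} (h : Normal w) (a : Fin n) :
    (run a n).foldr push w = w := by
  -- Take off the maximal initial run `a, …, a + m - 1` of `w`. The last `k = n - 1 - m` letters of
  -- the cycle extend this run to length `n - 1`; the letter `a + m` completes a cycle, which is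
  -- deleted; the first `m` letters then restore `w`.
  obtain ⟨m, w', rfl, hw'⟩ := exists_run_append a w
  have hm : m < n := by simpa using h _ (List.infix_append_left) (isChain_run a m)
  obtain ⟨k, hk⟩ := Nat.exists_eq_add_of_lt hm
  have hcyc : a + m • 1 + 1 + k • 1 = a := by
    have : n • (1 : Fin n) = m • 1 + 1 + k • 1 := by
      rw [congrArg (fun j : ℕ => j • (1 : Fin n)) hk]; simp only [add_smul, one_smul]; abel
    rw [add_assoc, add_assoc, ← add_assoc (m • (1 : Fin n)), ← this, card_nsmul_one, add_zero]
  have hw'n : Normal w' := h.of_infix List.infix_append_right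
  have hsplit : run a n = run a m ++ (a + m • 1) :: run (a + m • 1 + 1) k := by
    rw [show run a n = run a (m + (k + 1)) from congrArg _ (by omega), run_add]; rfl
  have hjoin : run (a + m • 1 + 1) k ++ (run a m ++ w') = run (a + m • 1 + 1) (k + m) ++ w' := by
    rw [run_add, hcyc, List.append_assoc]
  have hnorm : Normal (run (a + m • 1 + 1) (k + m) ++ w') := by
    refine (normal_of_length_lt (by simp; omega)).append hw'n fun c hc b hb => ?_
    rcases Nat.eq_zero_or_pos (k + m) with h0 | h0
    · simp [h0, run] at hc
    · obtain ⟨j, hj⟩ := Nat.exists_eq_succ_of_ne_zero h0.ne'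
      rw [hj, getLast?_run_succ, Option.mem_some_iff] at hc
      have : c + 1 = a + m • 1 := by
        rw [← hc]
        have : (j + 1 : ℕ) • (1 : Fin n) = k • 1 + m • 1 := by
          rw [← Nat.succ_eq_add_one, ← hj, add_smul]
        rw [add_assoc _ (j • (1 : Fin n)), ← succ_nsmul, this, ← add_assoc, hcyc]
      rw [this]; exact hw' b hb
  rw [hsplit, List.foldr_append, List.foldr_cons,
    foldr_push_of_normal (u := run (a + m • 1 + 1) k) (by rwa [hjoin]), hjoin,
    push_run (w := w'), foldr_push_of_normal h]
  rw [← List.cons_append]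
  congr 1
  change run (a + m • 1) (k + m + 1) = run (a + m • 1) n
  rw [show k + m + 1 = n by omega]

end CyclicWord

/-! ### Normal forms in the monoid -/

namespace CyclicMonoid

open CyclicWord

variable {n : ℕ} [NeZero n]

/-- The element of the cyclic monoid represented by a word. -/
def ofWord (w : List (Fin n)) : CyclicMonoid n :=
  PresentedMonoid.mk _ (FreeMonoid.ofList w)

/-- The generator `a` of the cyclic monoid. -/
def gen (a : Fin n) : CyclicMonoid n := PresentedMonoid.of _ a

lemma ofWord_nil : (ofWord [] : CyclicMonoid n) = 1 := rfl

lemma ofWord_cons (a : Fin n) (w : List (Fin n)) : ofWord (a :: w) = gen a * ofWord w := rfl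

lemma ofWord_append (u w : List (Fin n)) : ofWord (u ++ w) = ofWord u * ofWord w := rfl

lemma ofWord_surjective : Function.Surjective (ofWord : List (Fin n) → CyclicMonoid n) :=
  fun s => PresentedMonoid.surjective_mk s

lemma finRotate_pow_apply (k : ℕ) (i : Fin n) : (finRotate n ^ k) i = i + k • 1 := by
  induction k with
  | zero => simp
  | succ k ih =>
    rw [pow_succ', Equiv.Perm.mul_apply, ih, succ_nsmul, ← add_assoc]
    obtain ⟨m, rfl⟩ := Nat.exists_eq_succ_of_ne_zero (NeZero.ne n)
    exact finRotate_apply _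

lemma run_eq_ofFn (a : Fin n) (m : ℕ) : run a m = List.ofFn fun i : Fin m => a + (i : ℕ) • 1 := by
  induction m generalizing a with
  | zero => simp [run]
  | succ m ih =>
    rw [List.ofFn_succ, run, ih]
    simp [add_smul, add_assoc, add_comm]

lemma coe_nsmul_one (i : Fin n) : (i : ℕ) • (1 : Fin n) = i := by
  have h : ∀ k : ℕ, ((k • (1 : Fin n) : Fin n) : ℕ) = k % n := by
    intro k
    induction k with
    | zero => simp
    | succ k ih => rw [succ_nsmul, Fin.val_add, ih, Fin.val_one', Nat.add_mod_mod, Nat.mod_add_mod]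
  exact Fin.ext (by rw [h, Nat.mod_eq_of_lt i.2])

lemma permWord_eq (σ : Equiv.Perm (Fin n)) :
    permWord n σ = FreeMonoid.ofList (List.ofFn σ) := by
  have h (l : List (Fin n)) : (l.map FreeMonoid.of).prod = FreeMonoid.ofList l := by
    induction l with
    | nil => rfl
    | cons a l ih => rw [List.map_cons, List.prod_cons, ih]; rfl
  rw [permWord, ← h, List.map_ofFn]
  rfl

lemma permWord_finRotate_pow (k : ℕ) :
    permWord n (finRotate n ^ k) = FreeMonoid.ofList (run (k • 1) n) := by
  rw [permWord_eq, run_eq_ofFn]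
  congr 2
  ext1 i
  rw [finRotate_pow_apply, coe_nsmul_one, add_comm]

lemma ofWord_run (a : Fin n) : ofWord (run a n) = ofWord (run 0 n) := by
  symm
  refine PresentedMonoid.mk_eq_mk_of_rel ⟨finRotate n ^ (a : ℕ), ⟨(a : ℕ), by simp⟩, ?_, ?_⟩
  · simpa using (permWord_finRotate_pow (n := n) 0).symm
  · rw [permWord_finRotate_pow, coe_nsmul_one]

lemma permRel_run {u v : FreeMonoid (Fin n)}
    (h : permRel n (Subgroup.zpowers (finRotate n) : Set (Equiv.Perm (Fin n))) u v) :
    ∃ a b, u = FreeMonoid.ofList (run a n) ∧ v = FreeMonoid.ofList (run b n) := by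
  obtain ⟨σ, hσ, rfl, rfl⟩ := h
  obtain ⟨k, rfl⟩ := (mem_powers_iff_mem_zpowers (x := finRotate n)).2 hσ
  exact ⟨_, _, permWord_finRotate_pow 0, permWord_finRotate_pow k⟩

/-- A function on letters extends to the cyclic monoid once all full cycles have equal images. -/
def lift {M : Type*} [Monoid M] (f : Fin n → M)
    (h : ∀ a b, ((run a n).map f).prod = ((run b n).map f).prod) : CyclicMonoid n →* M :=
  PresentedMonoid.lift f fun u v huv => by
    obtain ⟨a, b, rfl, rfl⟩ := permRel_run huv
    simpa [FreeMonoid.lift_apply] using h a b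

lemma lift_ofWord {M : Type*} [Monoid M] (f : Fin n → M)
    (h : ∀ a b, ((run a n).map f).prod = ((run b n).map f).prod) (w : List (Fin n)) :
    lift f h (ofWord w) = (w.map f).prod :=
  FreeMonoid.lift_apply f _

/-- The central element `a_1 a_2 ⋯ a_n`. -/
def cycle (n : ℕ) [NeZero n] : CyclicMonoid n := ofWord (run 0 n)

/-- The run of length `n + 1` from `a` ends in `a` and both begins and ends with a full cycle; all
full cycles are equal in the monoid. -/
lemma commute_cycle (s : CyclicMonoid n) : Commute (cycle n) s := by
  obtain ⟨w, rfl⟩ := ofWord_surjective s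
  induction w with
  | nil => exact Commute.one_right _
  | cons a w ih =>
    refine Commute.mul_right (b := gen a) ?_ ih
    have h := congrArg ofWord (run_cycle_succ a)
    rw [ofWord_append, ofWord_cons, ofWord_cons, ofWord_run, ofWord_nil, ofWord_run (a + 1),
      mul_one] at h
    exact h

/-- The length of a word representing an element of the cyclic monoid. -/
def degree : CyclicMonoid n →* Multiplicative ℕ :=
  lift (fun _ => Multiplicative.ofAdd 1) (by simp)

lemma degree_ofWord (w : List (Fin n)) :
    degree (ofWord w) = Multiplicative.ofAdd w.length := by
  simp [degree, lift_ofWord, ← ofAdd_nsmul]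

/-- A letter, acting on normal words. -/
noncomputable def act (a : Fin n) : Function.End {w : List (Fin n) // Normal w} :=
  fun w => ⟨push a w.1, w.2.push a⟩

lemma prod_map_act (u : List (Fin n)) (w : {w : List (Fin n) // Normal w}) :
    ((u.map act).prod w).1 = u.foldr push w.1 := by
  induction u with
  | nil => rfl
  | cons a u ih => rw [List.foldr_cons, ← ih]; rfl

lemma prod_map_act_run (a : Fin n) : ((run a n).map act).prod = 1 :=
  funext fun w => Subtype.ext ((prod_map_act _ w).trans (foldr_push_run w.2 a))

/-- The action of the cyclic monoid on normal words. -/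
noncomputable def actHom : CyclicMonoid n →* Function.End {w : List (Fin n) // Normal w} :=
  lift act fun a b => by rw [prod_map_act_run, prod_map_act_run]

/-- The normal word representing `s` up to a power of the central element. -/
noncomputable def nf (s : CyclicMonoid n) : List (Fin n) := (actHom s ⟨[], normal_nil⟩).1

lemma normal_nf (s : CyclicMonoid n) : Normal (nf s) := (actHom s ⟨[], normal_nil⟩).2

lemma nf_ofWord (w : List (Fin n)) : nf (ofWord w) = w.foldr push [] := by
  rw [nf, actHom, lift_ofWord, prod_map_act]

lemma nf_ofWord_of_normal {w : List (Fin n)} (h : Normal w) : nf (ofWord w) = w := by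
  rw [nf_ofWord, foldr_push_of_normal (by simpa using h), List.append_nil]

lemma exists_eq_cycle_pow_mul (s : CyclicMonoid n) : ∃ k, s = cycle n ^ k * ofWord (nf s) := by
  obtain ⟨w, rfl⟩ := ofWord_surjective s
  rw [nf_ofWord]
  induction w with
  | nil => exact ⟨0, by simp⟩
  | cons a w ih =>
    obtain ⟨k, hk⟩ := ih
    rw [ofWord_cons, hk, List.foldr_cons]
    generalize w.foldr push [] = v
    rw [← mul_assoc, ((commute_cycle (gen a)).symm.pow_right k).eq, mul_assoc, ← ofWord_cons, push]
    split_ifs with h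
    · obtain ⟨t, ht⟩ := h
      refine ⟨k + 1, ?_⟩
      rw [← ht, List.drop_left' (length_run a n), ofWord_append, ofWord_run, pow_succ, mul_assoc]
      rfl
    · exact ⟨k, rfl⟩

lemma nf_cycle_pow_mul (k : ℕ) (s : CyclicMonoid n) : nf (cycle n ^ k * s) = nf s := by
  have h : actHom (cycle n) = 1 := by rw [cycle, actHom, lift_ofWord, prod_map_act_run]
  rw [nf, map_mul, map_pow, h, one_pow, one_mul, nf]

lemma degree_eq (k : ℕ) (w : List (Fin n)) :
    (degree (cycle n ^ k * ofWord w)).toAdd = k * n + w.length := by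
  simp [cycle, degree_ofWord]

/-- The normal word being known, the degree recovers the exponent of the central element. -/
lemma ext_nf {s t : CyclicMonoid n} (h : nf s = nf t) (hd : degree s = degree t) : s = t := by
  obtain ⟨k, hk⟩ := exists_eq_cycle_pow_mul s
  obtain ⟨l, hl⟩ := exists_eq_cycle_pow_mul t
  rw [hk, hl, h] at hd ⊢
  have := congrArg Multiplicative.toAdd hd
  rw [degree_eq, degree_eq, Nat.add_right_cancel_iff] at this
  rw [Nat.eq_of_mul_eq_mul_right (NeZero.pos n) this]

lemma length_nf_ofWord (w : List (Fin n)) : (nf (ofWord w)).length ≤ w.length := by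
  obtain ⟨k, hk⟩ := exists_eq_cycle_pow_mul (ofWord w)
  have := degree_eq k (nf (ofWord w))
  rw [← hk, degree_ofWord, toAdd_ofAdd] at this
  omega

/-- A word that is not normal loses at least one full cycle, hence length, on passing to its normal
form. -/
lemma nf_ofWord_of_length {w : List (Fin n)} (h : w.length ≤ (nf (ofWord w)).length) :
    nf (ofWord w) = w := by
  by_cases hw : Normal w
  · exact nf_ofWord_of_normal hw
  · obtain ⟨p, a, q, rfl⟩ := exists_run_of_not_normal hw
    have : ofWord (p ++ run a n ++ q) = cycle n ^ 1 * ofWord (p ++ q) := by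
      rw [ofWord_append, ofWord_append, ofWord_run, ofWord_append, pow_one, ← mul_assoc,
        (commute_cycle (ofWord p)).eq]
      rfl
    rw [this, nf_cycle_pow_mul] at h
    have h1 := length_nf_ofWord (p ++ q)
    have := NeZero.pos n
    simp at h h1
    omega

lemma nf_prod_eq (l : List (CyclicMonoid n)) : nf l.prod = nf (ofWord (l.map nf).flatten) := by
  have : ∃ k, l.prod = cycle n ^ k * ofWord (l.map nf).flatten := by
    induction l with
    | nil => exact ⟨0, by simp [ofWord_nil]⟩
    | cons s l ih =>
      obtain ⟨k, hk⟩ := ih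
      obtain ⟨j, hj⟩ := exists_eq_cycle_pow_mul s
      refine ⟨j + k, ?_⟩
      rw [List.prod_cons, hk, List.map_cons, List.flatten_cons, ofWord_append, pow_add]
      nth_rw 1 [hj]
      simp only [mul_assoc]
      rw [← mul_assoc (ofWord (nf s)), ((commute_cycle (ofWord (nf s))).symm.pow_right k).eq,
        mul_assoc]
  obtain ⟨k, hk⟩ := this
  rw [hk, nf_cycle_pow_mul]

lemma nf_prod_of_length {l : List (CyclicMonoid n)}
    (h : (l.map nf).flatten.length ≤ (nf l.prod).length) : nf l.prod = (l.map nf).flatten := by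
  rw [nf_prod_eq] at h ⊢; exact nf_ofWord_of_length h

lemma nf_prod_of_normal {l : List (CyclicMonoid n)} (h : Normal (l.map nf).flatten) :
    nf l.prod = (l.map nf).flatten := by
  rw [nf_prod_eq]; exact nf_ofWord_of_normal h

/-- Reversal combined with negation of letters sends runs to runs, so it respects the relations. -/
lemma reverse_map_neg_run (a : Fin n) (m : ℕ) :
    ((run a m).map Neg.neg).reverse = run (1 - (a + m • 1)) m := by
  induction m generalizing a with
  | zero => rfl
  | succ m ih =>
    rw [run, List.map_cons, List.reverse_cons, ih, run_add _ m 1, succ_nsmul]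
    simp only [run]
    congr 2
    · abel
    · abel

/-- The anti-automorphism of the cyclic monoid that reverses the order of the generators. -/
def revHom : CyclicMonoid n →* (CyclicMonoid n)ᵐᵒᵖ :=
  lift (fun a => MulOpposite.op (gen (-a))) fun a b => by
    suffices h : ∀ a : Fin n, ((run a n).map fun a => MulOpposite.op (gen (-a))).prod =
        MulOpposite.op (cycle n) by rw [h a, h b]
    intro a
    have (l : List (Fin n)) : (l.map fun a => MulOpposite.op (gen (-a))).prod =
        MulOpposite.op (ofWord (l.map Neg.neg).reverse) := by
      induction l with
      | nil => rfl
      | cons a l ih =>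
        rw [List.map_cons, List.prod_cons, ih, List.map_cons, List.reverse_cons, ofWord_append]
        rfl
    rw [this, reverse_map_neg_run, ofWord_run, cycle]

lemma revHom_gen (a : Fin n) : revHom (gen a) = MulOpposite.op (gen (-a)) := rfl

lemma unop_revHom_unop_revHom (s : CyclicMonoid n) : (revHom (revHom s).unop).unop = s := by
  obtain ⟨w, rfl⟩ := ofWord_surjective s
  induction w with
  | nil => simp [ofWord_nil]
  | cons a w ih => rw [ofWord_cons, map_mul, MulOpposite.unop_mul, map_mul, MulOpposite.unop_mul, ih,
      revHom_gen, MulOpposite.unop_op, revHom_gen, MulOpposite.unop_op, neg_neg]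

/-- The cyclic monoid is isomorphic to its opposite. -/
def opEquiv : (CyclicMonoid n)ᵐᵒᵖ ≃* CyclicMonoid n :=
  MulEquiv.symm
  { revHom with
    invFun := fun s => (revHom s.unop).unop
    left_inv := unop_revHom_unop_revHom
    right_inv := fun s => MulOpposite.unop_injective (unop_revHom_unop_revHom s.unop) }

end CyclicMonoid

/-! ### Joining normal words; marker words -/

namespace CyclicWord

variable {n : ℕ} [NeZero n]

/-- Two normal words can be joined by a letter so that the result is normal. -/
lemma Normal.exists_append_cons (hn : 3 ≤ n) {l r : List (Fin n)} (hl : Normal l)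
    (hr : Normal r) : ∃ b, Normal (l ++ b :: r) := by
  -- Each seam forbids at most one letter, and there are at least three letters. The default `0` for
  -- an empty word only forbids a letter needlessly.
  obtain ⟨b, hb⟩ : ∃ b, b ∉ ({l.getLast?.getD 0 + 1, r.head?.getD 0 - 1} : Finset (Fin n)) := by
    by_contra! h
    have h1 := Finset.card_le_card (fun b _ => h b :
      (Finset.univ : Finset (Fin n)) ⊆ {l.getLast?.getD 0 + 1, r.head?.getD 0 - 1})
    have h2 := Finset.card_le_two (a := l.getLast?.getD 0 + 1) (b := r.head?.getD 0 - 1)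
    simp only [Finset.card_univ, Fintype.card_fin] at h1
    omega
  simp only [Finset.mem_insert, Finset.mem_singleton, not_or] at hb
  refine ⟨b, hl.append ((normal_of_length_lt (w := [b]) ?_).append hr ?_) ?_⟩
  · simp; omega
  · intro a ha c hc hac
    simp only [List.getLast?_singleton, Option.mem_some_iff] at ha
    rw [Option.mem_def] at hc
    apply hb.2
    rw [hc, Option.getD_some, hac, ha, add_sub_cancel_right]
  · intro a ha c hc hac
    simp only [List.head?_cons, Option.mem_some_iff] at hc
    rw [Option.mem_def] at ha
    apply hb.1
    rw [ha, Option.getD_some, ← hac, hc]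

/-- The words `1, 0, …, 0`, none of which is a suffix of another. -/
def marker (n : ℕ) [NeZero n] (k : ℕ) : List (Fin n) := 1 :: List.replicate k 0

lemma normal_marker (hn : 3 ≤ n) (k : ℕ) : Normal (marker n k) := by
  have h01 : (0 : Fin n) ≠ 0 + 1 := by
    intro h
    have := congrArg Fin.val h
    simp [Nat.mod_eq_of_lt (show 1 < n by omega)] at this
  have h02 : (0 : Fin n) ≠ 1 + 1 := by
    intro h
    have := congrArg Fin.val h
    simp [Fin.val_add, Nat.mod_eq_of_lt (show 1 < n by omega),
      Nat.mod_eq_of_lt (show 2 < n by omega)] at this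
  have h : Normal (List.replicate k (0 : Fin n)) := by
    induction k with
    | zero => exact normal_nil
    | succ k ih =>
      refine (normal_of_length_lt (w := [0]) (by simp; omega)).append ih fun a ha b hb => ?_
      obtain rfl : 0 = a := by simpa using ha
      obtain rfl := List.eq_of_mem_replicate (List.mem_of_mem_head? hb)
      exact h01
  refine (normal_of_length_lt (w := [1]) (by simp; omega)).append h fun a ha b hb => ?_
  obtain rfl : 1 = a := by simpa using ha
  obtain rfl := List.eq_of_mem_replicate (List.mem_of_mem_head? hb)
  exact h02

lemma marker_suffix_injective (hn : 2 ≤ n) {k l : ℕ} {u w : List (Fin n)}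
    (h : u ++ marker n k = w ++ marker n l) : k = l := by
  have h01 : (1 : Fin n) ≠ 0 := by
    intro h
    have := congrArg Fin.val h
    simp [Nat.mod_eq_of_lt (show 1 < n by omega)] at this
  replace h := congrArg List.reverse h
  simp only [marker, List.reverse_append, List.reverse_cons, List.reverse_replicate,
    List.append_assoc, List.singleton_append] at h
  induction k generalizing l with
  | zero =>
    cases l with
    | zero => rfl
    | succ l => simp [List.replicate_succ, h01] at h
  | succ k ih =>
    cases l with
    | zero => simp [List.replicate_succ, h01.symm] at h
    | succ l =>
      simp only [List.replicate_succ, List.cons_append, List.cons.injEq, true_and] at h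
      rw [ih h]

end CyclicWord

/-! ### Unique products and a proper left ideal -/

namespace CyclicMonoid

open CyclicWord MonoidAlgebra

variable {n : ℕ} [NeZero n] {K : Type*} [Field K]

lemma nf_gen (hn : 2 ≤ n) (b : Fin n) : nf (gen b) = [b] :=
  nf_ofWord_of_normal (w := [b]) (normal_of_length_lt (by simp; omega))

variable (n K) in
/-- The sum of the generators. -/
noncomputable def genSum : MonoidAlgebra K (CyclicMonoid n) := ∑ b : Fin n, single (gen b) 1

lemma genSum_mul_mul_genSum_mul (r : MonoidAlgebra K (CyclicMonoid n)) (a v : CyclicMonoid n) (c : K) :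
    single a c * (genSum n K * r * genSum n K * single v 1) =
      ∑ b, ∑ y ∈ r.coeff.support, ∑ b', single (a * (gen b * (y * (gen b' * v)))) (c * r.coeff y) := by
  conv_lhs => rw [← sum_coeff_single r]
  simp only [genSum, Finsupp.sum, Finset.sum_mul, Finset.mul_sum, single_mul_single, one_mul,
    mul_one, mul_assoc]
  rw [Finset.sum_comm]
  conv_lhs => enter [2, y]; rw [Finset.sum_comm]
  rw [Finset.sum_comm]

/-- Among the products `x * gen b * y * gen b' * marker` with `x ∈ X i` and `y ∈ Y i`, some product
is attained only once, and it lies outside all the sets `X i`. -/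
lemma exists_unique_prod {I : Type*} (hn : 3 ≤ n) (φ : I → ℕ) (hφ : φ.Injective)
    (X Y : I → Finset (CyclicMonoid n)) (hY : ∀ i, (Y i).Nonempty) (J : Finset I)
    (hJ : ∃ i ∈ J, (X i).Nonempty) :
    ∃ i₀ ∈ J, ∃ x₀ ∈ X i₀, ∃ b₀, ∃ y₀ ∈ Y i₀, ∃ b₀',
      let m : I → CyclicMonoid n → Fin n → CyclicMonoid n → Fin n → CyclicMonoid n :=
        fun i x b y b' => x * (gen b * (y * (gen b' * ofWord (marker n (φ i)))))
      let s := m i₀ x₀ b₀ y₀ b₀'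
      s ≠ 1 ∧ (∀ i ∈ J, s ∉ X i) ∧
        ∀ i ∈ J, ∀ x ∈ X i, ∀ b, ∀ y ∈ Y i, ∀ b', m i x b y b' = s →
          i = i₀ ∧ x = x₀ ∧ b = b₀ ∧ y = y₀ ∧ b' = b₀' := by
  classical
  -- Length of the normal form comes first, as it detects cancellation; degree breaks ties between
  -- elements differing by a power of the central element.
  let key : CyclicMonoid n → ℕ ×ₗ ℕ := fun s => toLex ((nf s).length, (degree s).toAdd)
  choose y hy hymax using fun i => (Y i).exists_max_image key (hY i)
  -- The marker has length `φ i + 1`; the two joining letters account for the rest.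
  let D : I → ℕ := fun i => (nf (y i)).length + (φ i + 3)
  obtain ⟨⟨i₀, x₀⟩, hmem, hmax⟩ := (J.sigma X).exists_max_image
    (fun t => toLex ((nf t.2).length + D t.1, (degree t.2).toAdd) : (_ : I) × CyclicMonoid n → ℕ ×ₗ ℕ)
    (by obtain ⟨i, hi, x, hx⟩ := hJ; exact ⟨⟨i, x⟩, Finset.mem_sigma.2 ⟨hi, hx⟩⟩)
  rw [Finset.mem_sigma] at hmem
  obtain ⟨b', hb'⟩ := (normal_nf (y i₀)).exists_append_cons hn (normal_marker hn (φ i₀))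
  obtain ⟨b, hb⟩ := (normal_nf x₀).exists_append_cons hn hb'
  have hflat : ∀ i x b y b', (([x, gen b, y, gen b', ofWord (marker n (φ i))] :
      List (CyclicMonoid n)).map nf).flatten = nf x ++ b :: (nf y ++ b' :: marker n (φ i)) := by
    intro i x b y b'
    simp [nf_gen (show 2 ≤ n by omega), nf_ofWord_of_normal (normal_marker hn (φ i))]
  have hlen : ∀ i x b y b', (nf x ++ b :: (nf y ++ b' :: marker n (φ i)) : List (Fin n)).length =
      (nf x).length + ((nf y).length + (φ i + 3)) := by
    intro i x b y b'; simp [marker]; omega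
  have hprod : ∀ i x b y b', x * (gen b * (y * (gen b' * ofWord (marker n (φ i))))) =
      ([x, gen b, y, gen b', ofWord (marker n (φ i))] : List (CyclicMonoid n)).prod := by
    intro i x b y b'; simp
  have hnf : nf (x₀ * (gen b * (y i₀ * (gen b' * ofWord (marker n (φ i₀)))))) =
      nf x₀ ++ b :: (nf (y i₀) ++ b' :: marker n (φ i₀)) := by
    rw [hprod, nf_prod_of_normal (by rwa [hflat]), hflat]
  refine ⟨i₀, hmem.1, x₀, hmem.2, b, y i₀, hy i₀, b', ?_, ?_, ?_⟩
  · intro h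
    dsimp only at h
    rw [h, ← ofWord_nil, nf_ofWord_of_normal normal_nil] at hnf
    simp at hnf
  -- If the product lay in `X i`, it would exceed the maximum by `D i > 0`.
  · intro i hi hs
    have h1 := (Prod.Lex.le_iff'.1 (hmax ⟨i, _⟩ (Finset.mem_sigma.2 ⟨hi, hs⟩))).1
    have h2 := congrArg List.length hnf
    rw [hlen] at h2
    simp only [ofLex_toLex, D] at h1
    omega
  · intro i hi x hx c u hu c' h
    dsimp only at h
    have h1 := Prod.Lex.le_iff'.1 (hmax ⟨i, x⟩ (Finset.mem_sigma.2 ⟨hi, hx⟩))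
    have h2 := Prod.Lex.le_iff'.1 (hymax i u hu)
    have h3 := congrArg List.length hnf
    have h4 := hlen i x c u c'
    rw [hlen, ← h, hprod] at h3
    simp only [ofLex_toLex, D, key] at h1 h2
    -- The attained length is maximal, so a competing product has no cancellation and its normal
    -- form is the plain concatenation, which can be compared piece by piece.
    rw [← h, hprod, nf_prod_of_length (by rw [hflat]; omega), hflat] at hnf
    have hi : i = i₀ := hφ (marker_suffix_injective (show 2 ≤ n by omega)
      (u := nf x ++ c :: (nf u ++ [c'])) (w := nf x₀ ++ b :: (nf (y i₀) ++ [b'])) (by simpa using hnf))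
    subst hi
    have h5 := congrArg List.length hnf
    rw [hlen, hlen] at h5
    obtain ⟨hx1, hx2⟩ := List.append_inj hnf (by omega)
    rw [List.cons.injEq] at hx2
    obtain ⟨hc, hx2⟩ := hx2
    obtain ⟨hy1, hy2⟩ := List.append_inj hx2 (by omega)
    rw [List.cons.injEq] at hy2
    have hd := congrArg (fun s => (degree s).toAdd) h
    have hg : ∀ b : Fin n, degree (gen b) = Multiplicative.ofAdd 1 := fun b => degree_ofWord [b]
    simp only [map_mul, toAdd_mul, hg] at hd
    -- The lengths agree, so neither degree exceeds its maximum; since the total degrees are equal,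
    -- both are attained.
    have h6 := h1.2 (by omega)
    have h7 := h2.2 (by omega)
    exact ⟨rfl, ext_nf hx1 (Multiplicative.toAdd.injective (by omega)), hc,
      ext_nf hy1 (Multiplicative.toAdd.injective (by omega)), hy2.1⟩

lemma span_ne_top {I : Type*} (hn : 3 ≤ n) (φ : I → ℕ) (hφ : φ.Injective)
    (r : I → MonoidAlgebra K (CyclicMonoid n)) (hr : ∀ i, r i ≠ 0) :
    Ideal.span (Set.range fun i =>
      genSum n K * r i * genSum n K * single (ofWord (marker n (φ i))) 1 - 1) ≠ ⊤ := by
  classical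
  rw [Ideal.ne_top_iff_one]
  intro h
  obtain ⟨x, hx⟩ := Finsupp.mem_ideal_span_range_iff_exists_finsupp.1 h
  have hx0 : ∃ i ∈ x.support, (x i).coeff.support.Nonempty := by
    have : x ≠ 0 := by
      rintro rfl
      simp at hx
    obtain ⟨i, hi⟩ := Finsupp.support_nonempty_iff.2 this
    refine ⟨i, hi, ?_⟩
    rw [Finsupp.support_nonempty_iff, Ne, coeff_eq_zero]
    exact Finsupp.mem_support_iff.1 hi
  obtain ⟨i₀, hi₀, x₀, hx₀, b₀, y₀, hy₀, b₀', hs1, hsX, huniq⟩ := exists_unique_prod hn φ hφ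
    (fun i => (x i).coeff.support) (fun i => (r i).coeff.support)
    (fun i => Finsupp.support_nonempty_iff.2 (by simpa using hr i)) x.support hx0
  dsimp only at hs1 hsX huniq
  generalize hs : x₀ * (gen b₀ * (y₀ * (gen b₀' * ofWord (marker n (φ i₀))))) = s at *
  have hexp : ∀ i, x i * (genSum n K * r i * genSum n K * single (ofWord (marker n (φ i))) 1) =
      ∑ a ∈ (x i).coeff.support, ∑ b, ∑ y ∈ (r i).coeff.support, ∑ b',
        single (a * (gen b * (y * (gen b' * ofWord (marker n (φ i))))))
          ((x i).coeff a * (r i).coeff y) := by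
    intro i
    conv_lhs => rw [← sum_coeff_single (x i)]
    rw [Finsupp.sum, Finset.sum_mul]
    exact Finset.sum_congr rfl fun a _ => genSum_mul_mul_genSum_mul _ _ _ _
  -- At `s` the coefficient of `1` is zero, the subtracted `x i` contribute nothing, and exactly one
  -- product contributes, with nonzero coefficient.
  have hcoeff := congrArg (fun f => f.coeff s) hx
  have hone : (1 : MonoidAlgebra K (CyclicMonoid n)).coeff s = 0 := by
    rw [one_def, coeff_single, Finsupp.single_apply, if_neg hs1.symm]
  simp only [Finsupp.sum, mul_sub, mul_one, Finset.sum_sub_distrib, hexp, coeff_sub,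
    coeff_sum, Finsupp.sub_apply, Finsupp.finsetSum_apply, coeff_single, Finsupp.single_apply,
    hone] at hcoeff
  rw [Finset.sum_eq_zero (s := x.support) (f := fun i => (x i).coeff s)
    fun i hi => Finsupp.notMem_support_iff.1 (hsX i hi), sub_zero,
    Finset.sum_eq_single i₀, Finset.sum_eq_single x₀, Finset.sum_eq_single b₀,
    Finset.sum_eq_single y₀, Finset.sum_eq_single b₀', if_pos hs] at hcoeff
  · exact mul_ne_zero (Finsupp.mem_support_iff.1 hx₀) (Finsupp.mem_support_iff.1 hy₀) hcoeff
  · exact fun b' _ hb' => if_neg fun h => hb' (huniq i₀ hi₀ x₀ hx₀ b₀ y₀ hy₀ b' h).2.2.2.2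
  · exact fun h => absurd (Finset.mem_univ _) h
  · exact fun y hy hne => Finset.sum_eq_zero fun b' _ =>
      if_neg fun h => hne (huniq i₀ hi₀ x₀ hx₀ b₀ y hy b' h).2.2.2.1
  · exact fun h => absurd hy₀ h
  · exact fun b _ hne => Finset.sum_eq_zero fun y hy => Finset.sum_eq_zero fun b' _ =>
      if_neg fun h => hne (huniq i₀ hi₀ x₀ hx₀ b y hy b' h).2.2.1
  · exact fun h => absurd (Finset.mem_univ _) h
  · exact fun a ha hne => Finset.sum_eq_zero fun b _ => Finset.sum_eq_zero fun y hy =>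
      Finset.sum_eq_zero fun b' _ => if_neg fun h => hne (huniq i₀ hi₀ a ha b y hy b' h).2.1
  · exact fun h => absurd hx₀ h
  · exact fun i hi hne => Finset.sum_eq_zero fun a ha => Finset.sum_eq_zero fun b _ =>
      Finset.sum_eq_zero fun y hy => Finset.sum_eq_zero fun b' _ =>
      if_neg fun h => hne (huniq i hi a ha b y hy b' h).1
  · exact fun h => absurd hi₀ h

end CyclicMonoid

/-! ### Criteria for primitivity of general rings -/

/-- Being left primitive is invariant under ring isomorphisms. -/
lemma IsLeftPrimitive.of_ringEquiv {R S : Type u} [Ring R] [Ring S] (e : S ≃+* R)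
    (h : IsLeftPrimitive R) : IsLeftPrimitive S := by
  obtain ⟨M, _, _, hs, hf⟩ := h
  let _ : Module S M := Module.compHom M e.toRingHom
  refine ⟨M, inferInstance, inferInstance, ?_, ⟨fun {a b} hab => ?_⟩⟩
  · have : RingHomInvPair (e : S →+* R) (e.symm : R →+* S) := RingHomInvPair.of_ringEquiv e
    let l : M →ₛₗ[(e : S →+* R)] M :=
      { toFun := id, map_add' := fun _ _ => rfl, map_smul' := fun _ _ => rfl }
    exact (l.isSimpleModule_iff_of_bijective Function.bijective_id).2 hs
  · exact e.injective (hf.eq_of_smul_eq_smul hab)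

lemma isRightPrimitive_iff (R : Type u) [Ring R] :
    IsRightPrimitive R ↔ IsLeftPrimitive Rᵐᵒᵖ := Iff.rfl

/-- A ring is left primitive if some proper left ideal is comaximal with every nonzero two-sided
ideal. -/
lemma isLeftPrimitive_of_ideal {R : Type u} [Ring R] (L : Ideal R) (hL : L ≠ ⊤)
    (h : ∀ r : R, r ≠ 0 → ∃ a b : R, a * r * b - 1 ∈ L) : IsLeftPrimitive R := by
  obtain ⟨m, hm, hLm⟩ := Ideal.exists_le_maximal L hL
  refine ⟨R ⧸ m, inferInstance, inferInstance, isSimpleModule_iff_isCoatom.2 hm.out,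
    ⟨fun {r s} hrs => ?_⟩⟩
  by_contra hne
  -- If `r - s` kills the class of `b`, then `a * (r - s) * b` lies in `m`, and so does `1`.
  obtain ⟨a, b, hab⟩ := h (r - s) (sub_ne_zero.2 hne)
  have h0 : (r - s) • (Submodule.Quotient.mk b : R ⧸ m) = 0 := by
    rw [sub_smul, hrs, sub_self]
  have h1 : (r - s) * b ∈ m := (Submodule.Quotient.mk_eq_zero m).1 h0
  have h2 : a * (r - s) * b ∈ m := by rw [mul_assoc]; exact m.mul_mem_left a h1
  exact hm.ne_top ((Ideal.eq_top_iff_one m).2 (by simpa using m.sub_mem h2 (hLm hab)))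

/-- If `z` is a central element, transcendental over a field `K`, of an algebra of countable
dimension that has a faithful simple module, then `K` is countable. -/
lemma IsLeftPrimitive.countable {K : Type*} {R : Type u} [Field K] [Ring R] [Algebra K R]
    (hR : Module.rank K R ≤ Cardinal.aleph0) {z : R} (hz : ∀ r, Commute z r)
    (htr : Transcendental K z) (h : IsLeftPrimitive R) : Countable K := by
  classical
  obtain ⟨M, _, _, hs, hf⟩ := h
  let _ : Module K M := Module.compHom M (algebraMap K R)
  have : IsScalarTower K R M := ⟨fun k r m => by
    rw [Algebra.smul_def, mul_smul]; rfl⟩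
  have hcomm : ∀ (q : Polynomial K) (r : R), Commute (Polynomial.aeval z q) r := by
    intro q r
    induction q using Polynomial.induction_on' with
    | add p q hp hq => rw [map_add]; exact hp.add_left hq
    | monomial k c =>
      rw [Polynomial.aeval_monomial]
      exact (Algebra.commute_algebraMap_left c r).mul_left ((hz r).pow_left k)
  have hinj : ∀ q : Polynomial K, q ≠ 0 → Polynomial.aeval z q ≠ 0 := fun q hq h =>
    hq ((transcendental_iff.1 htr) q h)
  have hbij : ∀ q : Polynomial K, q ≠ 0 →
      Function.Bijective fun m : M => Polynomial.aeval z q • m := by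
    intro q hq
    let l : M →ₗ[R] M :=
      { toFun := fun m => Polynomial.aeval z q • m
        map_add' := smul_add _
        map_smul' := fun r m => by
          rw [RingHom.id_apply, ← mul_smul, ← mul_smul, (hcomm q r).eq] }
    refine l.bijective_or_eq_zero.resolve_right fun hl => hinj q hq (hf.eq_of_smul_eq_smul
      fun m : M => ?_)
    rw [zero_smul]
    exact LinearMap.congr_fun hl m
  have := IsSimpleModule.nontrivial R M
  obtain ⟨m, hm⟩ := exists_ne (0 : M)
  choose w hw using fun k : K => (hbij (Polynomial.X - Polynomial.C k)
    (Polynomial.X_sub_C_ne_zero k)).2 m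
  have hli : LinearIndependent K w := by
    rw [linearIndependent_iff']
    intro s g hg i hi
    by_contra hgi
    let P : K → Polynomial K := fun k => ∏ j ∈ s.erase k, (Polynomial.X - Polynomial.C j)
    have hP : ∀ k ∈ s, Polynomial.aeval z (∏ j ∈ s, (Polynomial.X - Polynomial.C j)) • w k =
        Polynomial.aeval z (P k) • m := by
      intro k hk
      rw [← Finset.prod_erase_mul _ _ hk, map_mul, mul_smul]
      exact congrArg _ (hw k)
    -- Clearing denominators in the relation makes this polynomial in `z` kill `m`. It is nonzero
    -- because at `i` only the term `k = i` survives.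
    have hq : ∑ k ∈ s, Polynomial.C (g k) * P k ≠ 0 := by
      intro h0
      have := congrArg (Polynomial.eval i) h0
      rw [Polynomial.eval_finsetSum, Finset.sum_eq_single i] at this
      · simp only [P, Polynomial.eval_mul, Polynomial.eval_C, Polynomial.eval_prod,
          Polynomial.eval_sub, Polynomial.eval_X, Polynomial.eval_zero, mul_eq_zero, hgi,
          false_or, Finset.prod_eq_zero_iff, sub_eq_zero] at this
        obtain ⟨j, hj, rfl⟩ := this
        exact Finset.notMem_erase _ _ hj
      · intro k _ hki
        simp only [P, Polynomial.eval_mul, Polynomial.eval_prod]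
        rw [Finset.prod_eq_zero (Finset.mem_erase.2 ⟨hki.symm, hi⟩) (by simp), mul_zero]
      · exact fun h => absurd hi h
    refine hm ((hbij _ hq).1 ?_)
    simp only [smul_zero, map_sum, map_mul, Polynomial.aeval_C, Finset.sum_smul]
    have h0 := congrArg
      (fun v => Polynomial.aeval z (∏ j ∈ s, (Polynomial.X - Polynomial.C j)) • v) hg
    simp only [Finset.smul_sum, smul_zero] at h0
    rw [← h0]
    refine Finset.sum_congr rfl fun k hk => ?_
    rw [mul_smul, ← hP k hk, ← mul_smul, Algebra.commutes, mul_smul, algebraMap_smul]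
  have hsurj : Function.Surjective ((LinearMap.toSpanSingleton R M m).restrictScalars K) :=
    IsSimpleModule.toSpanSingleton_surjective R hm
  have h1 := hli.cardinal_lift_le_rank
  have h2 := (LinearMap.rank_le_of_surjective _ hsurj).trans hR
  rw [← Cardinal.mk_le_aleph0_iff]
  simpa using h1.trans (Cardinal.lift_le.2 h2)

/-! ### Primitivity of the monoid algebra on both sides -/

namespace CyclicMonoid

open CyclicWord MonoidAlgebra

variable {n : ℕ} [NeZero n] {K : Type u} [Field K]

instance : Countable (CyclicMonoid n) := ofWord_surjective.countable

lemma isLeftPrimitive_of_countable (hn : 3 ≤ n) [Countable K] :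
    IsLeftPrimitive (MonoidAlgebra K (CyclicMonoid n)) := by
  have : Countable (MonoidAlgebra K (CyclicMonoid n)) := coeff_injective.countable
  obtain ⟨φ, hφ⟩ := exists_injective_nat {r : MonoidAlgebra K (CyclicMonoid n) // r ≠ 0}
  refine isLeftPrimitive_of_ideal _ (span_ne_top hn φ hφ Subtype.val Subtype.prop) fun r hr => ?_
  refine ⟨genSum n K, genSum n K * single (ofWord (marker n (φ ⟨r, hr⟩))) 1, ?_⟩
  rw [← mul_assoc]
  exact Ideal.subset_span ⟨⟨r, hr⟩, rfl⟩

lemma cycle_pow_injective : Function.Injective fun k : ℕ => cycle n ^ k := by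
  intro k l h
  have := congrArg (fun s => (degree s).toAdd) h
  simpa [cycle, degree_ofWord, NeZero.ne n] using this

/-- The powers of the cycle are distinct by degree, so they are distinct basis elements. -/
lemma transcendental_single_cycle : Transcendental K (single (cycle n) (1 : K)) := by
  rw [transcendental_iff]
  intro p hp
  ext k
  have h := congrArg (fun f => f.coeff (cycle n ^ k)) hp
  simp only [Polynomial.aeval_eq_sum_range, single_pow, one_pow, coeff_sum,
    Finsupp.finsetSum_apply, smul_single, smul_eq_mul, mul_one, coeff_single, coeff_zero,
    Finsupp.zero_apply] at h
  rw [Finset.sum_eq_single k] at h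
  · simpa using h
  · exact fun j _ hj => Finsupp.single_eq_of_ne fun h => hj (cycle_pow_injective h.symm)
  · intro hk
    rw [Finsupp.single_eq_same]
    exact Polynomial.coeff_eq_zero_of_natDegree_lt (by simpa using hk)

lemma commute_single_cycle (r : MonoidAlgebra K (CyclicMonoid n)) :
    Commute (single (cycle n) (1 : K)) r :=
  single_commute commute_cycle (fun _ => Commute.one_left _) r

lemma isLeftPrimitive_iff (hn : 3 ≤ n) :
    IsLeftPrimitive (MonoidAlgebra K (CyclicMonoid n)) ↔ Countable K := by
  refine ⟨fun h => h.countable (K := K) ?_ commute_single_cycle transcendental_single_cycle,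
    fun _ => isLeftPrimitive_of_countable hn⟩
  have h := (MonoidAlgebra.basis (CyclicMonoid n) K).mk_eq_rank
  rw [← Cardinal.lift_le_aleph0, ← h, Cardinal.lift_le_aleph0]
  exact Cardinal.mk_le_aleph0

/-- The algebra of the cyclic monoid is isomorphic to its opposite. -/
noncomputable def algebraOpEquiv :
    (MonoidAlgebra K (CyclicMonoid n))ᵐᵒᵖ ≃+* MonoidAlgebra K (CyclicMonoid n) :=
  MonoidAlgebra.opRingEquiv.trans
    ((mapDomainRingEquiv _ opEquiv).trans (mapRingEquiv _ (RingEquiv.toOpposite K).symm))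

lemma isRightPrimitive_iff (hn : 3 ≤ n) :
    IsRightPrimitive (MonoidAlgebra K (CyclicMonoid n)) ↔ Countable K := by
  rw [_root_.isRightPrimitive_iff, ← isLeftPrimitive_iff hn]
  exact ⟨.of_ringEquiv algebraOpEquiv.symm, .of_ringEquiv algebraOpEquiv⟩

end CyclicMonoid

theorem theorem3 (n : ℕ) (hn : 3 ≤ n) (K : Type*) [Field K] :
    (IsRightPrimitive (MonoidAlgebra K (CyclicMonoid n)) ↔ Countable K) ∧
      (IsLeftPrimitive (MonoidAlgebra K (CyclicMonoid n)) ↔ Countable K) := by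
  have : NeZero n := ⟨by omega⟩
  exact ⟨CyclicMonoid.isRightPrimitive_iff hn, CyclicMonoid.isLeftPrimitive_iff hn⟩
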